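/- Let $\zeta$ be a transcendental real number. For $n\ge 1$ let $w_n(\zeta)\in[-\infty,\infty]$ be the supremum of the real numbers $w$ such that $0<|P(\zeta)|\le H(P)^{-w}$ has infinitely many solutions $P\in\mathbb{Z}[T]$ of degree at most $n$, where $H(P)$ is the maximum modulus of the coefficients of $P$. Let $\lambda_n(\zeta)\in[-\infty,\infty]$ be the supremum of the real numbers $\lambda$ such that the system $1\le |x|\le X$, $\max_{1\le i\le n}|\zeta^i x-y_i|\le X^{-\lambda}$ has a solution $(x,y_1,\dots,y_n)\in\mathbb{Z}^{n+1}$ for arbitrarily large $X$. Put $$\overline{w}=\limsup_{n\to\infty}\frac{w_n(\zeta)}{n},\quad \underline{w}=\liminf_{n\to\infty}\frac{w_n(\zeta)}{n},\quad \overline{\lambda}=\limsup_{n\to\infty} n\lambda_n(\zeta),\quad \underline{\lambda}=\liminf_{n\to\infty} n\lambda_n(\zeta).$$ Then $$\frac{(\overline{w}+1)^2}{4\overline{w}}\le\overline{\lambda},\qquad \frac{(\underline{w}+1)^2}{4\underline{w}}\le\underline{\lambda},$$ where $(w+1)^2/(4w)$ is read as $\infty$ for $w=\infty$. In particular, if $\zeta$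 is a $T$-number, that is, if $w_n(\zeta)<\infty$ for all $n\ge 1$ and $\overline{w}=\infty$, then $\limsup_{n\to\infty} n\lambda_n(\zeta)=\infty$. Moreover, for all integers $m,n\ge 1$ and every real $C\ge 1$ with $w_n(\zeta)\ge Cn$, $$\lambda_{m+n}(\zeta)\ge\frac{Cn-m}{m+n(1+C(n-1))}.$$ -/

import Mathlib

open Filter Polynomial

noncomputable section

namespace DiophExp

/-- The exponent `w_n(ζ)`: the supremum in `[-∞, ∞]` of the real numbers `w` such that
`0 < |P(ζ)| ≤ H(P)^(-w)` has infinitely many solutions `P ∈ ℤ[T]` of degree at most `n`.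
The height `H(P)`, the maximum modulus of the coefficients of `P`, is `Polynomial.supNorm`. -/
def wExp (n : ℕ) (ζ : ℝ) : EReal :=
  sSup {e : EReal | ∃ w : ℝ, e = (w : EReal) ∧
    {P : ℤ[X] | P.natDegree ≤ n ∧ 0 < |aeval ζ P| ∧ |aeval ζ P| ≤ P.supNorm ^ (-w)}.Infinite}

/-- The exponent `λ_n(ζ)`: the supremum in `[-∞, ∞]` of the real numbers `l` such that the system
`1 ≤ |x| ≤ X`, `|ζ^i x - y_i| ≤ X^(-l)` (`1 ≤ i ≤ n`) has an integer solution
`(x, y_1, …, y_n)` for arbitrarily large real `X`.  The entry `y i` below is `y_{i+1}`. -/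
def lambdaExp (n : ℕ) (ζ : ℝ) : EReal :=
  sSup {e : EReal | ∃ l : ℝ, e = (l : EReal) ∧
    ∃ᶠ X : ℝ in atTop, ∃ (x : ℤ) (y : Fin n → ℤ),
      1 ≤ |x| ∧ (|x| : ℝ) ≤ X ∧
      ∀ i : Fin n, |ζ ^ ((i : ℕ) + 1) * (x : ℝ) - (y i : ℝ)| ≤ X ^ (-l)}

/-- `limsup w_n(ζ) / n`. -/
def wUpper (ζ : ℝ) : EReal := limsup (fun n : ℕ => wExp n ζ / (n : EReal)) atTop

/-- `liminf w_n(ζ) / n`. -/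
def wLower (ζ : ℝ) : EReal := liminf (fun n : ℕ => wExp n ζ / (n : EReal)) atTop

/-- `limsup n * λ_n(ζ)`. -/
def lambdaUpper (ζ : ℝ) : EReal := limsup (fun n : ℕ => (n : EReal) * lambdaExp n ζ) atTop

/-- `liminf n * λ_n(ζ)`. -/
def lambdaLower (ζ : ℝ) : EReal := liminf (fun n : ℕ => (n : EReal) * lambdaExp n ζ) atTop

/-- The quantity `(w + 1)² / (4 w)`, with its limit `∞` as value at `w = ∞`
(where the quotient in `EReal` would be `∞ / ∞ = 0`). -/
def quadRatio (w : EReal) : EReal := if w = ⊤ then ⊤ else (w + 1) ^ 2 / (4 * w)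

/-- Mahler's `T`-numbers: transcendental real numbers `ζ` with `w_n(ζ) < ∞` for all `n ≥ 1` and
`limsup w_n(ζ) / n = ∞`. -/
def IsTNumber (ζ : ℝ) : Prop :=
  Transcendental ℚ ζ ∧ (∀ n : ℕ, 1 ≤ n → wExp n ζ < ⊤) ∧ wUpper ζ = ⊤

end DiophExp

end

/-!
The lower bound for `λ_{m+n}` comes from the geometry of numbers.  Let `P` have degree at most `n`,
height `H` and `|P(ζ)| ≤ H ^ (-w)`.  The integer vectors `(z_0, …, z_{m+n})` annihilated by all
shifts `∑ p_k z_{j+k} = 0`, `0 ≤ j ≤ m`, form a lattice of rank `n` and determinant `≪ H ^ (m+1)`.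
On it the errors `e_i = z_i - ζ ^ i z_0` satisfy a recurrence with coefficients `p_k` and a
right-hand side of size `|z_0 P(ζ)|`, so `n - 1` of them control the others.  Minkowski's theorem on
linear forms (`exists_int_linear_forms_lt`), applied to `z_0`, to `n - 1` errors and to the `m + 1` shifts, which
are forced to vanish because they are integers of modulus less than one, gives a point with
`|z_0| ≪ H ^ α` and all errors `≪ H ^ (-β)`, where `α = ((n - 1) w + n + m) / n` and
`β = (w - m) / n`.  For `w → C n` the quotient `β / α` tends to the bound of the theorem.

The recurrence can be solved with bounded constants when the leading coefficient of `P` is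
comparable to `H` (`exists_approx_of_dominant_leading`).  In general, `|P(a)| ≫ H` for some
`a ∈ {0, …, n}` (`exists_supNorm_le_abs_eval`), and one passes to the reversal of `P(T + a)`, with
leading coefficient `P(a)`, and to `1 / (ζ - a)` in place of `ζ`; simultaneous approximations are
carried back by `exists_approx_inv` and `exists_approx_add_int`.

For the asymptotic statements, put `N = m + n` with `m / n → (C - 1) / 2`, the maximum point of the
limit `(1 + μ) (C - μ) / C` of `N` times the bound as `m / n → μ` (`tendsto_mul_exponent`).  The
maximum is `(C + 1) ^ 2 / (4 C)`, and `C` increases to `w`.  This needs `C ≥ 1`, that is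
`w_n ≥ n` (`natCast_le_wExp`), which is Minkowski's theorem once more.
-/

/-! ### Linear forms and recurrences -/

/-- **Minkowski's theorem on linear forms**, with strict inequalities. -/
theorem exists_int_linear_forms_lt {d : ℕ} (A : Matrix (Fin d) (Fin d) ℝ) (c : Fin d → ℝ)
    (hc : ∀ i, 0 < c i) (hA : A.det ≠ 0) (h : |A.det| < ∏ i, c i) :
    ∃ v : Fin d → ℤ, v ≠ 0 ∧ ∀ i, |∑ j, A i j * (v j : ℝ)| < c i := by
  set b := Pi.basisFun ℝ (Fin d)
  set s : Set (Fin d → ℝ) :=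
    (Matrix.toLin' A) ⁻¹' (Set.pi Set.univ fun i => Set.Ioo (-c i) (c i)) with hs
  have hmem : ∀ x, x ∈ s ↔ ∀ i, |∑ j, A i j * x j| < c i := by
    intro x
    simp [hs, Matrix.mulVec, dotProduct, abs_lt]
  have hdet : LinearMap.det (Matrix.toLin' A) ≠ 0 := by rwa [LinearMap.det_toLin']
  have hvol : MeasureTheory.volume s = ENNReal.ofReal (|A.det|⁻¹ * ∏ i, (2 * c i)) := by
    rw [hs, MeasureTheory.Measure.addHaar_preimage_linearMap _ hdet, Real.volume_pi_Ioo,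
      LinearMap.det_toLin', abs_inv, ENNReal.ofReal_mul (by positivity),
      ENNReal.ofReal_prod_of_nonneg (fun i _ => by linarith [hc i])]
    congr 2
    ext i
    congr 1
    ring
  have : Countable (Submodule.span ℤ (Set.range b)).toAddSubgroup :=
    inferInstanceAs (Countable (Submodule.span ℤ (Set.range b)))
  obtain ⟨x, hx0, hxs⟩ := MeasureTheory.exists_ne_zero_mem_lattice_of_measure_mul_two_pow_lt_measure
    (μ := MeasureTheory.volume) (s := s)
    (ZSpan.isAddFundamentalDomain' b MeasureTheory.volume)
    (by
      intro x hx
      rw [hmem] at hx ⊢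
      intro i
      simpa [abs_neg] using hx i)
    ((convex_pi fun i _ => convex_Ioo _ _).linear_preimage _)
    (by
      rw [ZSpan.volume_fundamentalDomain, hvol]
      have h1 : Matrix.of b = (1 : Matrix (Fin d) (Fin d) ℝ) := by
        ext i j
        simp [b, Matrix.one_apply, Pi.single_apply, eq_comm]
      rw [h1, Matrix.det_one, abs_one, ENNReal.ofReal_one, one_mul, Module.finrank_fin_fun,
        Finset.prod_mul_distrib, Finset.prod_const, Finset.card_univ, Fintype.card_fin]
      have h2 : (2 : ENNReal) ^ d = ENNReal.ofReal (2 ^ d) := by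
        rw [ENNReal.ofReal_pow (by norm_num)]
        norm_num
      rw [h2]
      have hp : 0 < |A.det| := abs_pos.mpr hA
      have hcp : 0 < ∏ i, c i := Finset.prod_pos fun i _ => hc i
      refine (ENNReal.ofReal_lt_ofReal_iff (by positivity)).2 ?_
      rw [inv_mul_eq_div, lt_div_iff₀ hp]
      exact mul_lt_mul_of_pos_left h (by positivity))
  have hint : ∀ i, ∃ z : ℤ, (z : ℝ) = (x : Fin d → ℝ) i := by
    intro i
    have := (b.mem_span_iff_repr_mem ℤ (x : Fin d → ℝ)).1 x.2 i
    simpa [b] using this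
  choose v hv using hint
  refine ⟨v, ?_, ?_⟩
  · rintro rfl
    apply hx0
    ext i
    simpa using (hv i).symm
  · intro i
    simp only [hv]
    exact (hmem _).1 hxs i

/-- Solutions of a linear recurrence whose leading coefficient dominates the others are bounded in
terms of their initial values. -/
theorem abs_le_of_recurrence {n N : ℕ} (hn : 1 ≤ n) {K M δ : ℝ} (hK : 0 ≤ K) (hM : 0 ≤ M)
    (hδ : 0 ≤ δ) (r : ℕ → ℝ) (hr : r n ≠ 0) (hrK : ∀ k < n, |r k| ≤ K * |r n|) (e : ℕ → ℝ)
    (he : ∀ i < n, |e i| ≤ δ)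
    (hrec : ∀ j, n + j ≤ N → |∑ k ∈ Finset.range (n + 1), r k * e (j + k)| ≤ M * |r n| * δ) :
    ∀ i ≤ N, |e i| ≤ (1 + n * K + M) ^ i * δ := by
  have hB : 1 ≤ 1 + n * K + M := by
    have : 0 ≤ n * K := by positivity
    linarith
  intro i
  induction i using Nat.strong_induction_on with
  | _ i ih =>
    intro hi
    rcases lt_or_ge i n with h | h
    · exact (he i h).trans (le_mul_of_one_le_left hδ (one_le_pow₀ hB))
    · obtain ⟨j, rfl⟩ := Nat.exists_eq_add_of_le h
      set B := 1 + n * K + M with hBdef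
      have hpos : 0 < |r n| := abs_pos.mpr hr
      have hs := hrec j hi
      rw [Finset.sum_range_succ] at hs
      have h1 : |∑ k ∈ Finset.range n, r k * e (j + k)|
          ≤ n * (K * |r n| * (B ^ (n + j - 1) * δ)) := by
        refine (Finset.abs_sum_le_sum_abs _ _).trans ?_
        refine (Finset.sum_le_card_nsmul _ _ (K * |r n| * (B ^ (n + j - 1) * δ)) ?_).trans ?_
        · intro k hk
          have hk' := Finset.mem_range.1 hk
          rw [abs_mul]
          refine mul_le_mul (hrK k hk') ((ih (j + k) (by omega) (by omega)).trans ?_)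
            (abs_nonneg _) (by positivity)
          refine mul_le_mul_of_nonneg_right (pow_le_pow_right₀ hB (by omega)) hδ
        · simp
      have h2 : |r n * e (j + n)| ≤ M * |r n| * δ + n * (K * |r n| * (B ^ (n + j - 1) * δ)) := by
        have := abs_add_le (∑ k ∈ Finset.range n, r k * e (j + k) + r n * e (j + n))
          (-∑ k ∈ Finset.range n, r k * e (j + k))
        rw [abs_neg] at this
        have h3 : ∑ k ∈ Finset.range n, r k * e (j + k) + r n * e (j + n)
          + (-∑ k ∈ Finset.range n, r k * e (j + k)) = r n * e (j + n) := by ring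
        rw [h3] at this
        linarith
      rw [abs_mul, add_comm j n] at h2
      have h4 : |r n| * |e (n + j)| ≤ |r n| * (M * δ + n * K * (B ^ (n + j - 1) * δ)) := by
        linarith
      have h5 := le_of_mul_le_mul_left h4 hpos
      have hB1 : 1 ≤ B ^ (n + j - 1) := one_le_pow₀ hB
      have h6 : B ^ (n + j) = B ^ (n + j - 1) * B := by
        rw [← pow_succ]
        congr 1
        omega
      rw [h6]
      have h7 : M * δ ≤ M * (B ^ (n + j - 1) * δ) :=
        mul_le_mul_of_nonneg_left (le_mul_of_one_le_left hδ hB1) hM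
      have h8 : 0 ≤ B ^ (n + j - 1) * δ := by positivity
      calc |e (n + j)| ≤ M * δ + n * K * (B ^ (n + j - 1) * δ) := h5
        _ ≤ (M + n * K) * (B ^ (n + j - 1) * δ) := by linarith
        _ ≤ B * (B ^ (n + j - 1) * δ) := by
            refine mul_le_mul_of_nonneg_right ?_ h8
            rw [hBdef]; linarith
        _ = _ := by ring

/-- The matrix, in the variables `v₀, …, v_{n+m}`, of the linear forms `v₀`, `v_i - η ^ i v₀` for
`1 ≤ i < n`, and `∑ₖ r k * v_{j+k}` for `j ≤ m`.  It is lower triangular, with diagonal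
`1, …, 1, r n, …, r n`. -/
noncomputable def recurrenceMatrix (m n : ℕ) (η : ℝ) (r : ℕ → ℝ) :
    Matrix (Fin (n + (m + 1))) (Fin (n + (m + 1))) ℝ :=
  Matrix.of fun i l =>
    if (i : ℕ) < n then (if l = i then 1 else if (l : ℕ) = 0 then -η ^ (i : ℕ) else 0)
    else if (i : ℕ) ≤ l + n ∧ (l : ℕ) ≤ i then r (l + n - i) else 0

theorem det_recurrenceMatrix (m n : ℕ) (η : ℝ) (r : ℕ → ℝ) :
    (recurrenceMatrix m n η r).det = r n ^ (m + 1) := by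
  rw [Matrix.det_of_isLowerTriangular]
  · rw [Fin.prod_univ_add]
    simp [recurrenceMatrix]
  · intro i j hij
    have hij' : i < j := hij
    have h1 : (i : ℕ) < j := hij'
    have h2 : j ≠ i := hij'.ne'
    have h3 : ¬ (j : ℕ) ≤ i := by omega
    have h4 : (j : ℕ) ≠ 0 := by omega
    simp only [recurrenceMatrix, Matrix.of_apply]
    split_ifs <;> simp_all

theorem recurrenceMatrix_sum_initial {m n : ℕ} (η : ℝ) (r : ℕ → ℝ) (v : ℕ → ℝ)
    (i : Fin (n + (m + 1))) (hi : (i : ℕ) < n) (hi0 : (i : ℕ) ≠ 0) :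
    ∑ l, recurrenceMatrix m n η r i l * v l = v i - η ^ (i : ℕ) * v 0 := by
  have h0 : (⟨0, by omega⟩ : Fin (n + (m + 1))) ≠ i := by
    intro h; apply hi0; rw [← h]
  rw [← Finset.add_sum_erase _ _ (Finset.mem_univ i),
    ← Finset.add_sum_erase _ _ (Finset.mem_erase.2 ⟨h0, Finset.mem_univ _⟩),
    Finset.sum_eq_zero]
  · simp only [recurrenceMatrix, Matrix.of_apply, if_pos hi, if_neg h0, if_true]
    ring
  · intro l hl
    simp only [Finset.mem_erase, Finset.mem_univ, and_true] at hl
    have : (l : ℕ) ≠ 0 := fun h => hl.1 (Fin.ext h)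
    simp only [recurrenceMatrix, Matrix.of_apply, if_pos hi, if_neg hl.2, if_neg this, zero_mul]

theorem recurrenceMatrix_sum_zero {m n : ℕ} (hn : 1 ≤ n) (η : ℝ) (r : ℕ → ℝ) (v : ℕ → ℝ)
    (i : Fin (n + (m + 1))) (hi0 : (i : ℕ) = 0) :
    ∑ l, recurrenceMatrix m n η r i l * v l = v 0 := by
  rw [← Finset.add_sum_erase _ _ (Finset.mem_univ i), Finset.sum_eq_zero]
  · have h1 : (i : ℕ) < n := by omega
    simp only [recurrenceMatrix, Matrix.of_apply, if_pos h1, if_true, one_mul]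
    rw [hi0, add_zero]
  · intro l hl
    simp only [Finset.mem_erase, Finset.mem_univ, and_true] at hl
    have h1 : (i : ℕ) < n := by omega
    have h2 : (l : ℕ) ≠ 0 := fun h => hl (Fin.ext (by omega))
    simp only [recurrenceMatrix, Matrix.of_apply, if_pos h1, if_neg hl, if_neg h2, zero_mul]

theorem recurrenceMatrix_sum_recurrence {m n : ℕ} (η : ℝ) (r : ℕ → ℝ) (v : ℕ → ℝ)
    (i : Fin (n + (m + 1))) (j : ℕ) (hi : (i : ℕ) = n + j) :
    ∑ l, recurrenceMatrix m n η r i l * v l =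
      ∑ k ∈ Finset.range (n + 1), r k * v (j + k) := by
  have hlt := i.2
  have h1 : ∑ l, recurrenceMatrix m n η r i l * v l = ∑ l : Fin (n + (m + 1)),
      (fun l : ℕ => if j ≤ l ∧ l ≤ j + n then r (l - j) * v l else 0) l := by
    refine Finset.sum_congr rfl fun l _ => ?_
    have h2 : ¬ (i : ℕ) < n := by omega
    simp only [recurrenceMatrix, Matrix.of_apply, if_neg h2, ite_mul, zero_mul]
    refine if_congr (by omega) ?_ rfl
    congr 2
    omega
  rw [h1, Fin.sum_univ_eq_sum_range (fun l : ℕ => if j ≤ l ∧ l ≤ j + n then r (l - j) * v l else 0),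
    ← Finset.sum_filter]
  refine (Finset.sum_bij (fun k _ => j + k) ?_ ?_ ?_ ?_).symm
  · intro k hk
    simp only [Finset.mem_filter, Finset.mem_range] at hk ⊢
    omega
  · intro a _ b _ h
    omega
  · intro l hl
    simp only [Finset.mem_filter, Finset.mem_range] at hl
    exact ⟨l - j, Finset.mem_range.2 (by omega), by omega⟩
  · intro k _
    simp

/-- A polynomial `∑ r k * T ^ k` with dominating leading coefficient, small at `η`, yields a
simultaneous approximation to the powers of `η`.  Minkowski's theorem forces the integer recurrence
`∑ₖ r k * v_{j+k} = 0`, so that only the first `n - 1` errors need to be controlled. -/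
theorem exists_approx_of_dominant_leading {m n : ℕ} (hn : 1 ≤ n) {η K M X δ : ℝ} (hK : 0 ≤ K)
    (hM : 0 ≤ M) (hX : 0 < X) (hδ : 0 < δ) (r : ℕ → ℤ) (hr : r n ≠ 0)
    (hrK : ∀ k < n, (|r k| : ℝ) ≤ K * |(r n : ℝ)|)
    (hvol : (2 * |(r n : ℝ)|) ^ (m + 1) < X * δ ^ (n - 1))
    (hsmall : ∀ j ≤ m, |η| ^ j * (X * |∑ k ∈ Finset.range (n + 1), (r k : ℝ) * η ^ k|)
      ≤ M * |(r n : ℝ)| * δ) :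
    ∃ v : ℕ → ℤ, (∃ i ≤ n + m, v i ≠ 0) ∧ |(v 0 : ℝ)| ≤ X ∧
      ∀ i ≤ n + m, |(v i : ℝ) - η ^ i * v 0| ≤ (1 + n * K + M) ^ (n + m) * δ := by
  have hrR : (r n : ℝ) ≠ 0 := by exact_mod_cast hr
  have hrp : 0 < |(r n : ℝ)| := abs_pos.mpr hrR
  set A := recurrenceMatrix m n η (fun k => (r k : ℝ)) with hAdef
  -- The bound `1 / 2` makes the integer values of the last `m + 1` forms vanish.
  let c : ℕ → ℝ := fun i => if i = 0 then X else if i < n then δ else 1 / 2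
  have hAdet : A.det = (r n : ℝ) ^ (m + 1) := det_recurrenceMatrix _ _ _ _
  have hprod : ∏ i : Fin (n + (m + 1)), c i = X * δ ^ (n - 1) * (1 / 2) ^ (m + 1) := by
    rw [Fin.prod_univ_eq_prod_range c, Finset.prod_range_add]
    obtain ⟨n', rfl⟩ : ∃ n', n = n' + 1 := ⟨n - 1, by omega⟩
    rw [Finset.prod_range_succ']
    have h1 : ∏ k ∈ Finset.range n', c (k + 1) = δ ^ n' := by
      rw [Finset.prod_congr rfl (g := fun _ => δ)]
      · simp
      · intro k hk
        have := Finset.mem_range.1 hk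
        simp [c, this]
    have h2 : ∏ x ∈ Finset.range (m + 1), c (n' + 1 + x) = (1 / 2) ^ (m + 1) := by
      rw [Finset.prod_congr rfl (g := fun _ => (1 / 2 : ℝ))]
      · simp
      · intro k _
        have h3 : n' + 1 + k ≠ 0 := by omega
        have h4 : ¬ n' + 1 + k < n' + 1 := by omega
        simp only [c, if_neg h3, if_neg h4]
    have h5 : c 0 = X := if_pos rfl
    rw [h1, h2, h5, Nat.add_sub_cancel]
    ring
  obtain ⟨v₀, hv0, hv⟩ := exists_int_linear_forms_lt A (fun i => c i)
    (by intro i; simp only [c]; split_ifs <;> positivity)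
    (by rw [hAdet]; exact pow_ne_zero _ hrR)
    (by
      rw [hprod, hAdet, abs_pow, one_div, inv_pow, ← div_eq_mul_inv, lt_div_iff₀ (by positivity),
        ← mul_pow, mul_comm]
      exact hvol)
  let v : ℕ → ℤ := fun i => if h : i < n + (m + 1) then v₀ ⟨i, h⟩ else 0
  have hvv : ∀ l : Fin (n + (m + 1)), (v₀ l : ℝ) = (fun i => (v i : ℝ)) l := by
    intro l; simp [v]
  simp only [hvv] at hv
  have hfirst : |(v 0 : ℝ)| ≤ X := by
    have := hv ⟨0, by omega⟩
    rw [hAdef, recurrenceMatrix_sum_zero hn η _ (fun i => (v i : ℝ)) _ rfl] at this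
    simpa [c] using this.le
  have hrecur : ∀ j ≤ m, ∑ k ∈ Finset.range (n + 1), (r k : ℝ) * v (j + k) = 0 := by
    intro j hj
    have := hv ⟨n + j, by omega⟩
    rw [hAdef, recurrenceMatrix_sum_recurrence η _ (fun i => (v i : ℝ)) _ j rfl] at this
    have h0 : n ≠ 0 := by omega
    simp only [c, Nat.add_eq_zero_iff, h0, false_and, if_false, Nat.not_lt.2 (Nat.le_add_right n j)]
      at this
    have h2 : |∑ k ∈ Finset.range (n + 1), r k * v (j + k)| < 1 := by
      have h3 : (|((∑ k ∈ Finset.range (n + 1), r k * v (j + k) : ℤ) : ℝ)|) < 1 := by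
        push_cast; linarith
      exact_mod_cast h3
    have h4 := Int.abs_lt_one_iff.1 h2
    exact_mod_cast h4
  refine ⟨v, ?_, hfirst, ?_⟩
  · obtain ⟨i, hi⟩ := Function.ne_iff.1 hv0
    exact ⟨i, by omega, by simpa [v] using hi⟩
  · intro i hi
    have hB : 1 ≤ 1 + n * K + M := by
      have : 0 ≤ n * K := by positivity
      linarith
    refine (abs_le_of_recurrence (N := n + m) hn hK hM hδ.le (fun k => (r k : ℝ)) hrR hrK
      (fun i => (v i : ℝ) - η ^ i * v 0) ?_ ?_ i hi).trans
      (mul_le_mul_of_nonneg_right (pow_le_pow_right₀ hB hi) hδ.le)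
    · intro i hi
      rcases Nat.eq_zero_or_pos i with rfl | h0
      · simpa using hδ.le
      · have := hv ⟨i, by omega⟩
        rw [hAdef, recurrenceMatrix_sum_initial η _ (fun i => (v i : ℝ)) _ hi h0.ne'] at this
        simpa [c, h0.ne', hi] using this.le
    · intro j hj
      have hj' : j ≤ m := by omega
      have h1 : ∑ k ∈ Finset.range (n + 1), (r k : ℝ) * ((v (j + k) : ℝ) - η ^ (j + k) * v 0)
          = -(η ^ j * (v 0 * ∑ k ∈ Finset.range (n + 1), (r k : ℝ) * η ^ k)) := by
        have : ∀ k, (r k : ℝ) * ((v (j + k) : ℝ) - η ^ (j + k) * v 0)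
          = (r k : ℝ) * v (j + k) - η ^ j * (v 0 * (r k * η ^ k)) := by
          intro k; ring
        simp only [this, Finset.sum_sub_distrib, hrecur j hj', Finset.mul_sum]
        ring
      rw [h1, abs_neg, abs_mul, abs_mul, abs_pow]
      refine le_trans ?_ (hsmall j hj')
      gcongr

/-! ### Integer polynomials of bounded degree -/

theorem abs_coeff_le_supNorm (P : ℤ[X]) (k : ℕ) : |(P.coeff k : ℝ)| ≤ P.supNorm := by
  have := P.le_supNorm k
  rwa [Int.norm_eq_abs] at this

theorem one_le_supNorm {P : ℤ[X]} (hP : P ≠ 0) : 1 ≤ P.supNorm := by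
  have h1 : 1 ≤ |P.leadingCoeff| := Int.one_le_abs (leadingCoeff_ne_zero.2 hP)
  have h2 : (1 : ℝ) ≤ |(P.leadingCoeff : ℝ)| := by exact_mod_cast h1
  exact h2.trans (abs_coeff_le_supNorm P _)

theorem finite_setOf_natDegree_le_supNorm_le (n : ℕ) (B : ℝ) :
    {P : ℤ[X] | P.natDegree ≤ n ∧ P.supNorm ≤ B}.Finite := by
  refine Set.Finite.of_injOn (f := fun P (i : Fin (n + 1)) => P.coeff i)
    (t := Set.pi Set.univ fun _ => Set.Icc (-⌈B⌉) ⌈B⌉) ?_ ?_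
    (Set.Finite.pi fun _ => Set.finite_Icc _ _)
  · intro P hP i _
    have h := ((abs_coeff_le_supNorm P i).trans hP.2).trans (Int.le_ceil B)
    rw [Set.mem_Icc, ← abs_le]
    exact_mod_cast h
  · intro P hP Q hQ h
    ext k
    rcases Nat.lt_or_ge k (n + 1) with hk | hk
    · exact congrFun h ⟨k, hk⟩
    · rw [coeff_eq_zero_of_natDegree_lt (lt_of_le_of_lt hP.1 hk),
        coeff_eq_zero_of_natDegree_lt (lt_of_le_of_lt hQ.1 hk)]

theorem exists_mem_of_eventually_supNorm {n : ℕ} {S : Set ℤ[X]} (hS : S.Infinite)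
    (hn : ∀ P ∈ S, P.natDegree ≤ n) {p : ℝ → Prop} (hp : ∀ᶠ H in atTop, p H) :
    ∃ P ∈ S, p P.supNorm := by
  obtain ⟨B, hB⟩ := eventually_atTop.1 hp
  by_contra! h
  refine hS ((finite_setOf_natDegree_le_supNorm_le n B).subset fun P hP => ⟨hn P hP, ?_⟩)
  by_contra! hlt
  exact h P hP (hB _ hlt.le)

theorem exists_abs_coeff_taylor_le (n : ℕ) (a : ℤ) :
    ∃ K : ℝ, 0 < K ∧ ∀ P : ℤ[X], P.natDegree ≤ n → ∀ k,
      |((taylor a P).coeff k : ℝ)| ≤ K * P.supNorm := by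
  refine ⟨1 + ∑ i ∈ Finset.range (n + 1), ((X + C a : ℤ[X]) ^ i).supNorm, ?_, ?_⟩
  · have := Finset.sum_nonneg fun i (_ : i ∈ Finset.range (n + 1)) =>
      ((X + C a : ℤ[X]) ^ i).supNorm_nonneg
    linarith
  · intro P hP k
    have h1 : taylor a P = ∑ i ∈ Finset.range (n + 1), C (P.coeff i) * (X + C a) ^ i := by
      conv_lhs => rw [P.as_sum_range' (n + 1) (Nat.lt_succ_of_le hP)]
      simp [taylor_monomial]
    rw [h1, finsetSum_coeff]
    push_cast
    refine (Finset.abs_sum_le_sum_abs _ _).trans ?_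
    rw [add_mul, Finset.sum_mul]
    refine le_trans (Finset.sum_le_sum fun i _ => ?_) (le_add_of_nonneg_left (by
      simpa using P.supNorm_nonneg))
    rw [coeff_C_mul, Int.cast_mul, abs_mul, mul_comm]
    exact mul_le_mul (abs_coeff_le_supNorm _ _) (abs_coeff_le_supNorm _ _) (abs_nonneg _)
      (supNorm_nonneg _)

/-- A polynomial of degree at most `n` is comparable to its height at one of `0, …, n`: its
coefficients are recovered from these values by inverting a Vandermonde matrix. -/
theorem exists_supNorm_le_abs_eval (n : ℕ) :
    ∃ c : ℝ, 0 < c ∧ ∀ P : ℤ[X], P.natDegree ≤ n →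
      ∃ a ∈ Finset.range (n + 1), c * P.supNorm ≤ |((P.eval (a : ℤ) : ℤ) : ℝ)| := by
  set V : Matrix (Fin (n + 1)) (Fin (n + 1)) ℝ :=
    Matrix.vandermonde fun i : Fin (n + 1) => ((i : ℕ) : ℝ) with hV
  have hdet : IsUnit V.det := by
    rw [isUnit_iff_ne_zero, hV, Matrix.det_vandermonde_ne_zero_iff]
    intro i j h
    exact Fin.ext (Nat.cast_injective h)
  set S : ℝ := ∑ i, ∑ a, |V⁻¹ i a| with hS
  have hS0 : 0 ≤ S := by positivity
  refine ⟨(S + 1)⁻¹, by positivity, fun P hP => ?_⟩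
  by_contra! h
  have hval : V.mulVec (fun i => (P.coeff i : ℝ))
      = fun a : Fin (n + 1) => ((P.eval ((a : ℕ) : ℤ) : ℤ) : ℝ) := by
    ext a
    rw [eval_eq_sum_range' (Nat.lt_succ_of_le hP), ← Fin.sum_univ_eq_sum_range
      (fun i => P.coeff i * ((a : ℕ) : ℤ) ^ i)]
    simp [Matrix.mulVec, dotProduct, hV, Matrix.vandermonde_apply, mul_comm]
  have hinv : (fun i : Fin (n + 1) => (P.coeff i : ℝ))
      = V⁻¹.mulVec fun a : Fin (n + 1) => ((P.eval ((a : ℕ) : ℤ) : ℤ) : ℝ) := by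
    rw [← hval, Matrix.mulVec_mulVec, Matrix.nonsing_inv_mul _ hdet, Matrix.one_mulVec]
  have hH : 0 < P.supNorm := by
    have h1 := (abs_nonneg _).trans_lt (h 0 (by simp))
    exact pos_of_mul_pos_right h1 (by positivity)
  obtain ⟨k, hk⟩ := P.exists_eq_supNorm
  rw [Int.norm_eq_abs] at hk
  have hkn : k < n + 1 := by
    by_contra! hlt
    rw [coeff_eq_zero_of_natDegree_lt (lt_of_le_of_lt hP hlt)] at hk
    simp at hk
    linarith
  have h2 : |(P.coeff k : ℝ)| ≤ S * ((S + 1)⁻¹ * P.supNorm) := by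
    have h3 := congrFun hinv ⟨k, hkn⟩
    simp only [Matrix.mulVec, dotProduct] at h3
    rw [h3]
    refine (Finset.abs_sum_le_sum_abs _ _).trans ?_
    have h4 : ∑ a, |V⁻¹ ⟨k, hkn⟩ a| ≤ S := by
      rw [hS]
      exact Finset.single_le_sum (f := fun i => ∑ a, |V⁻¹ i a|)
        (fun i _ => Finset.sum_nonneg fun a _ => abs_nonneg _) (Finset.mem_univ _)
    refine le_trans ?_ (mul_le_mul_of_nonneg_right h4 (by positivity))
    rw [Finset.sum_mul]
    refine Finset.sum_le_sum fun a _ => ?_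
    rw [abs_mul]
    exact mul_le_mul_of_nonneg_left (h a (Finset.mem_range.2 a.2)).le (abs_nonneg _)
  rw [← hk, ← mul_assoc, ← div_eq_mul_inv] at h2
  have h5 : S / (S + 1) < 1 := by rw [div_lt_one (by positivity)]; linarith
  nlinarith

/-! ### Moving simultaneous approximations along `η ↦ 1 / η + a` -/

/-- Simultaneous approximations to the powers of `η` read backwards approximate the powers of
`η⁻¹`. -/
theorem exists_approx_inv {N : ℕ} {η X δ : ℝ} (hη : η ≠ 0) {v : ℕ → ℤ}
    (hv : ∃ i ≤ N, v i ≠ 0) (h0 : |(v 0 : ℝ)| ≤ X)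
    (happ : ∀ i ≤ N, |(v i : ℝ) - η ^ i * v 0| ≤ δ)
    (hδ : ((1 + |η⁻¹|) ^ N + 1) * δ < 1) :
    ∃ u : ℕ → ℤ, u 0 ≠ 0 ∧ |(u 0 : ℝ)| ≤ |η| ^ N * X + δ ∧
      ∀ i ≤ N, |(η⁻¹) ^ i * u 0 - u i| ≤ ((1 + |η⁻¹|) ^ N + 1) * δ := by
  have hδ0 : 0 ≤ δ := (abs_nonneg _).trans (happ 0 (Nat.zero_le _))
  have key : ∀ i ≤ N, |(η⁻¹) ^ i * v (N - 0) - v (N - i)| ≤ ((1 + |η⁻¹|) ^ N + 1) * δ := by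
    intro i hi
    have h1 : (η⁻¹) ^ i * (v (N - 0) : ℝ) - v (N - i) =
        (η⁻¹) ^ i * (v N - η ^ N * v 0) - (v (N - i) - η ^ (N - i) * v 0) := by
      have h2 : η ^ N = η ^ i * η ^ (N - i) := by rw [← pow_add]; congr 1; omega
      rw [h2, inv_pow, Nat.sub_zero]
      field_simp
      ring
    rw [h1]
    refine (abs_sub _ _).trans ?_
    rw [abs_mul, abs_pow, add_mul, one_mul]
    refine add_le_add (mul_le_mul ?_ (happ N le_rfl) (abs_nonneg _) (by positivity))
      (happ _ (Nat.sub_le _ _))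
    exact (pow_le_pow_left₀ (abs_nonneg _) (by linarith) i).trans
      (pow_le_pow_right₀ (by linarith [abs_nonneg η⁻¹]) hi)
  refine ⟨fun i => v (N - i), ?_, ?_, key⟩
  · intro hz
    obtain ⟨i, hi, hne⟩ := hv
    have h1 := (key (N - i) (Nat.sub_le _ _)).trans_lt hδ
    simp only at hz
    rw [hz, Nat.sub_sub_self hi] at h1
    simp only [Int.cast_zero, mul_zero, zero_sub, abs_neg] at h1
    have h2 : |v i| < 1 := by exact_mod_cast h1
    exact hne (Int.abs_lt_one_iff.1 h2)
  · have h1 : (v N : ℝ) = η ^ N * v 0 + (v N - η ^ N * v 0) := by ring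
    simp only [Nat.sub_zero]
    rw [h1]
    refine (abs_add_le _ _).trans (add_le_add ?_ (happ N le_rfl))
    rw [abs_mul, abs_pow]
    gcongr

/-- Translation by an integer `a`: the `y i` are the binomial transforms of the `u i`. -/
theorem exists_approx_add_int {N : ℕ} {ξ D : ℝ} (a : ℤ) {u : ℕ → ℤ}
    (happ : ∀ i ≤ N, |ξ ^ i * u 0 - u i| ≤ D) :
    ∃ y : ℕ → ℤ, ∀ i ≤ N, |(ξ + a) ^ i * u 0 - y i| ≤ (1 + |(a : ℝ)|) ^ N * D := by
  have hD : 0 ≤ D := (abs_nonneg _).trans (happ 0 (Nat.zero_le _))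
  refine ⟨fun i => ∑ k ∈ Finset.range (i + 1), u k * a ^ (i - k) * i.choose k, fun i hi => ?_⟩
  have h1 : (ξ + a) ^ i * u 0
      - ((∑ k ∈ Finset.range (i + 1), u k * a ^ (i - k) * i.choose k : ℤ) : ℝ)
      = ∑ k ∈ Finset.range (i + 1), (ξ ^ k * u 0 - u k) * ((a : ℝ) ^ (i - k) * i.choose k) := by
    rw [add_pow, Finset.sum_mul]
    push_cast
    rw [← Finset.sum_sub_distrib]
    exact Finset.sum_congr rfl fun k _ => by ring
  rw [h1]
  refine (Finset.abs_sum_le_sum_abs _ _).trans ?_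
  calc ∑ k ∈ Finset.range (i + 1), |(ξ ^ k * u 0 - u k) * ((a : ℝ) ^ (i - k) * i.choose k)|
      ≤ ∑ k ∈ Finset.range (i + 1), D * (1 ^ k * |(a : ℝ)| ^ (i - k) * i.choose k) := by
        refine Finset.sum_le_sum fun k hk => ?_
        have hk' := Finset.mem_range.1 hk
        rw [abs_mul, abs_mul, abs_pow, one_pow, one_mul, Nat.abs_cast]
        exact mul_le_mul_of_nonneg_right (happ k (by omega)) (by positivity)
    _ = (1 + |(a : ℝ)|) ^ i * D := by rw [← Finset.mul_sum, ← add_pow, mul_comm]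
    _ ≤ _ := mul_le_mul_of_nonneg_right
        (pow_le_pow_right₀ (by linarith [abs_nonneg (a : ℝ)]) hi) hD

/-! ### Lower bounds for `λ_{m+n}` -/

/-- A polynomial `P` of height `H` with `|P(ζ)| ≤ H ^ (-w)`, comparable to its height at the
integer `a`, yields a simultaneous approximation to the powers of `ζ`.  It is obtained from
`exists_approx_of_dominant_leading`, applied to the reversal of `P(T + a)`, whose leading
coefficient is `P(a)`, and to `η = 1 / (ζ - a)`.  With `X ≍ H ^ α` and `δ ≍ H ^ (-β)`, the volume
condition reads `α - (n - 1) * β = m + 1` and the smallness of `P(ζ)` reads `α - w = 1 - β`; the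
exponents `α = ((n - 1) * w + n + m) / n` and `β = (w - m) / n` are the solution of this system. -/
theorem exists_approx_of_small_value {m n : ℕ} (hn : 1 ≤ n) {ζ w c : ℝ} (a : ℤ) (ha : ζ ≠ a)
    (hw : (m : ℝ) < w) (hc : 0 < c) :
    ∃ A B : ℝ, 0 < A ∧ 0 < B ∧ ∀ᶠ H : ℝ in atTop, ∀ P : ℤ[X], P.supNorm = H →
      P.natDegree ≤ n → |aeval ζ P| ≤ H ^ (-w) → c * H ≤ |((P.eval a : ℤ) : ℝ)| →
      ∃ (x : ℤ) (y : ℕ → ℤ), 1 ≤ |x| ∧ (|x| : ℝ) ≤ A * H ^ (((n - 1) * w + n + m) / n) ∧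
        ∀ i ≤ m + n, |ζ ^ i * x - y i| ≤ B * H ^ (-((w - m) / n)) := by
  obtain ⟨K₁, hK₁, htaylor⟩ := exists_abs_coeff_taylor_le n a
  set ξ : ℝ := ζ - a with hξ
  have hξ0 : ξ ≠ 0 := sub_ne_zero.2 ha
  set η : ℝ := ξ⁻¹ with hη
  have hη0 : η ≠ 0 := inv_ne_zero hξ0
  set κ : ℝ := (2 * K₁) ^ (m + 1) + 1 with hκ
  have hκ1 : 1 ≤ κ := by
    have : 0 ≤ (2 * K₁) ^ (m + 1) := by positivity
    linarith
  have hκ0 : 0 < κ := by linarith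
  set M : ℝ := (1 + |η|) ^ (m + n) / c with hM
  have hM0 : 0 ≤ M := by positivity
  set α : ℝ := ((n - 1) * w + n + m) / n with hα
  set β : ℝ := (w - m) / n with hβ
  have hn0 : (0 : ℝ) < n := by exact_mod_cast hn
  have hn1 : (1 : ℝ) ≤ n := by exact_mod_cast hn
  have hw0 : 0 < w := lt_of_le_of_lt (Nat.cast_nonneg m) hw
  have hβ0 : 0 < β := div_pos (by linarith) hn0
  have hα0 : 0 < α := by
    have : 0 ≤ ((n : ℝ) - 1) * w := mul_nonneg (by linarith) hw0.le
    exact div_pos (by positivity) hn0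
  set D : ℝ := (1 + n * (K₁ / c) + M) ^ (n + m) with hD
  have hD0 : 0 < D := by positivity
  set E : ℝ := (1 + |η⁻¹|) ^ (n + m) + 1 with hE
  have hE0 : 0 < E := by positivity
  have hlim : Tendsto (fun H : ℝ => E * (D * (κ * H ^ (-β)))) atTop (nhds 0) := by
    have := (((tendsto_rpow_neg_atTop hβ0).const_mul κ).const_mul D).const_mul E
    simpa using this
  refine ⟨|η| ^ (n + m) * κ + D * κ, (1 + |(a : ℝ)|) ^ (n + m) * (E * (D * κ)), by positivity,
    by positivity, ?_⟩
  filter_upwards [hlim.eventually (gt_mem_nhds one_pos), eventually_ge_atTop 1] with H hH1 hH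
    P hPH hPn hPζ hPa
  have hH0 : 0 < H := by linarith
  have hP0 : 0 < |((P.eval a : ℤ) : ℝ)| := lt_of_lt_of_le (by positivity) hPa
  set Q := taylor a P with hQ
  have hQn : Q.natDegree ≤ n := by rw [hQ, natDegree_taylor]; exact hPn
  have hQ0 : Q.coeff 0 = P.eval a := taylor_coeff_zero a P
  set r : ℕ → ℤ := fun k => Q.coeff (n - k) with hr
  have hrn : r n = P.eval a := by simp [hr, hQ0]
  have hrle : ∀ k, |(r k : ℝ)| ≤ K₁ * H := fun k => by
    rw [← hPH]; exact htaylor P hPn _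
  have hRη : ∑ k ∈ Finset.range (n + 1), (r k : ℝ) * η ^ k = η ^ n * aeval ζ P := by
    have h1 : aeval ζ P = ∑ k ∈ Finset.range (n + 1), (Q.coeff k : ℝ) * ξ ^ k := by
      have h2 : aeval ξ Q = aeval ζ P := by
        rw [hQ, taylor_apply, aeval_comp]
        congr 1
        simp [hξ]
      rw [← h2, aeval_eq_sum_range' (Nat.lt_succ_of_le hQn)]
      simp
    rw [h1, Finset.mul_sum, ← Finset.sum_range_reflect]
    refine Finset.sum_congr rfl fun k hk => ?_
    have hk' : k ≤ n := Nat.lt_succ_iff.1 (Finset.mem_range.1 hk)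
    have h3 : n + 1 - 1 - k = n - k := by omega
    have h4 : η ^ n = η ^ (n - k) * η ^ k := by rw [← pow_add]; congr 1; omega
    have h5 : η ^ k * ξ ^ k = 1 := by rw [← mul_pow, hη, inv_mul_cancel₀ hξ0, one_pow]
    simp only [hr, h3, Nat.sub_sub_self hk', h4]
    linear_combination -(Q.coeff k : ℝ) * η ^ (n - k) * h5
  have hαβ : α - β * (n - 1) = m + 1 := by rw [hα, hβ]; field_simp; ring
  have hαw : α - w = 1 - β := by rw [hα, hβ]; field_simp; ring
  obtain ⟨v, hv, hv0, happ⟩ := exists_approx_of_dominant_leading (m := m) (η := η) (K := K₁ / c)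
    (M := M) (X := κ * H ^ α) (δ := κ * H ^ (-β)) hn (by positivity) hM0 (by positivity)
    (by positivity) r (by
      rw [hrn]; intro h; rw [h] at hP0; simp at hP0)
    (by
      intro k _
      rw [hrn]
      calc |(r k : ℝ)| ≤ K₁ * H := hrle k
        _ = K₁ / c * (c * H) := by field_simp
        _ ≤ _ := by gcongr)
    (by
      have h1 : κ * H ^ α * (κ * H ^ (-β)) ^ (n - 1) = κ ^ n * H ^ (m + 1) := by
        rw [mul_pow, ← Real.rpow_mul_natCast hH0.le, mul_mul_mul_comm, ← pow_succ',
          Nat.sub_add_cancel hn, ← Real.rpow_add hH0, ← Real.rpow_natCast H (m + 1)]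
        congr 2
        push_cast [Nat.cast_sub hn]
        linarith
      rw [h1]
      calc (2 * |(r n : ℝ)|) ^ (m + 1) ≤ (2 * (K₁ * H)) ^ (m + 1) := by
            gcongr; exact hrle n
        _ = (2 * K₁) ^ (m + 1) * H ^ (m + 1) := by rw [← mul_pow]; ring
        _ < κ ^ n * H ^ (m + 1) := by
            refine mul_lt_mul_of_pos_right ?_ (by positivity)
            refine lt_of_lt_of_le ?_ (le_self_pow₀ hκ1 (by omega))
            rw [hκ]; linarith)
    (by
      intro j hj
      rw [hRη, hrn, abs_mul, abs_pow]
      have h1 : |η| ^ j * |η| ^ n ≤ (1 + |η|) ^ (m + n) := by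
        rw [← pow_add]
        exact (pow_le_pow_left₀ (abs_nonneg _) (by linarith) _).trans
          (pow_le_pow_right₀ (by linarith [abs_nonneg η]) (by omega))
      have h2 : H ^ α * H ^ (-w) = H * H ^ (-β) := by
        rw [← Real.rpow_add hH0, ← sub_eq_add_neg, hαw, Real.rpow_sub hH0, Real.rpow_one,
          Real.rpow_neg hH0.le, div_eq_mul_inv]
      calc |η| ^ j * (κ * H ^ α * (|η| ^ n * |aeval ζ P|))
          = (|η| ^ j * |η| ^ n) * (κ * (H ^ α * |aeval ζ P|)) := by ring
        _ ≤ (1 + |η|) ^ (m + n) * (κ * (H ^ α * H ^ (-w))) := by gcongr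
        _ = M * (c * H) * (κ * H ^ (-β)) := by rw [h2, hM]; field_simp
        _ ≤ _ := by gcongr)
  obtain ⟨u, hu0, huX, hu⟩ := exists_approx_inv hη0 hv hv0 happ hH1
  have hηinv : η⁻¹ = ξ := by rw [hη, inv_inv]
  rw [hηinv] at hu
  obtain ⟨y, hy⟩ := exists_approx_add_int a hu
  have hsum : ξ + a = ζ := by rw [hξ]; ring
  rw [hsum] at hy
  refine ⟨u 0, y, Int.one_le_abs hu0, ?_, fun i hi => ?_⟩
  · refine huX.trans ?_
    have : H ^ (-β) ≤ H ^ α := Real.rpow_le_rpow_of_exponent_le hH (by linarith)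
    calc |η| ^ (n + m) * (κ * H ^ α) + D * (κ * H ^ (-β))
        ≤ |η| ^ (n + m) * (κ * H ^ α) + D * (κ * H ^ α) := by gcongr
      _ = _ := by ring
  · refine (hy i (by omega)).trans (le_of_eq ?_)
    rw [hE, hηinv]; ring

namespace DiophExp

theorem zero_le_lambdaExp (n : ℕ) (ζ : ℝ) : 0 ≤ lambdaExp n ζ := by
  refine le_sSup ⟨0, by simp, ?_⟩
  refine ((eventually_ge_atTop (1 : ℝ)).mono fun X hX => ?_).frequently
  refine ⟨1, fun i => ⌊ζ ^ ((i : ℕ) + 1)⌋, by simp, by simpa using hX, fun i => ?_⟩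
  simp only [Int.cast_one, mul_one, neg_zero, Real.rpow_zero]
  rw [abs_le]
  constructor <;> linarith [Int.floor_le (ζ ^ ((i : ℕ) + 1)),
    Int.lt_floor_add_one (ζ ^ ((i : ℕ) + 1))]

/-- The hypothesis `hl` says `l < β / α` for the exponents `α`, `β` of
`exists_approx_of_small_value`; the strict inequality absorbs its constants. -/
theorem le_lambdaExp_of_infinite {m n : ℕ} (hn : 1 ≤ n) {ζ w c l : ℝ} (a : ℤ) (ha : ζ ≠ a)
    (hw : (m : ℝ) < w) (hc : 0 < c) (hl : l * ((n - 1) * w + n + m) < w - m)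
    (hS : {P : ℤ[X] | P.natDegree ≤ n ∧ |aeval ζ P| ≤ P.supNorm ^ (-w) ∧
      c * P.supNorm ≤ |((P.eval a : ℤ) : ℝ)|}.Infinite) :
    (l : EReal) ≤ lambdaExp (m + n) ζ := by
  obtain ⟨A, B, hA, hB, hev⟩ := exists_approx_of_small_value hn a ha hw hc
  refine le_sSup ⟨l, rfl, ?_⟩
  set α : ℝ := ((n - 1) * w + n + m) / n with hα
  set β : ℝ := (w - m) / n with hβ
  have hn0 : (0 : ℝ) < n := by exact_mod_cast hn
  have hn1 : (1 : ℝ) ≤ n := by exact_mod_cast hn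
  have hw0 : 0 < w := lt_of_le_of_lt (Nat.cast_nonneg m) hw
  have hα0 : 0 < α := by
    have : 0 ≤ ((n : ℝ) - 1) * w := mul_nonneg (by linarith) hw0.le
    exact div_pos (by positivity) hn0
  have hlαβ : 0 < β - α * l := by
    have : β - α * l = (w - m - l * ((n - 1) * w + n + m)) / n := by rw [hα, hβ]; ring
    rw [this]
    exact div_pos (by linarith) hn0
  have hlim : Tendsto (fun H : ℝ => B * A ^ l * H ^ (-(β - α * l))) atTop (nhds 0) := by
    simpa using (tendsto_rpow_neg_atTop hlαβ).const_mul (B * A ^ l)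
  rw [frequently_atTop]
  intro X₀
  obtain ⟨P, hP, happ, hX, hsmall, hH⟩ := exists_mem_of_eventually_supNorm hS (fun P hP => hP.1)
    (hev.and ((((tendsto_rpow_atTop hα0).const_mul_atTop hA).eventually_ge_atTop X₀).and
      ((hlim.eventually (gt_mem_nhds one_pos)).and (eventually_ge_atTop 1))))
  obtain ⟨x, y, hx1, hx, hy⟩ := happ P rfl hP.1 hP.2.1 hP.2.2
  have hH0 : 0 < P.supNorm := by linarith
  refine ⟨_, hX, x, fun i => y (i + 1), hx1, hx, fun i => (hy _ (by omega)).trans ?_⟩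
  rw [Real.mul_rpow hA.le (by positivity), ← Real.rpow_mul hH0.le, Real.rpow_neg hA.le,
    ← div_eq_inv_mul, le_div_iff₀ (by positivity)]
  have h1 : P.supNorm ^ (-β) = P.supNorm ^ (-(β - α * l)) * P.supNorm ^ (α * -l) := by
    rw [← Real.rpow_add hH0]; congr 1; ring
  rw [h1]
  calc B * (P.supNorm ^ (-(β - α * l)) * P.supNorm ^ (α * -l)) * A ^ l
      = B * A ^ l * P.supNorm ^ (-(β - α * l)) * P.supNorm ^ (α * -l) := by ring
    _ ≤ 1 * P.supNorm ^ (α * -l) := by gcongr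
    _ = _ := one_mul _

/-- As nonzero integer polynomials have height at least one, the exponents `w` in the definition of
`wExp` form a lower set. -/
theorem infinite_of_lt_wExp {n : ℕ} {ζ w : ℝ} (h : (w : EReal) < wExp n ζ) :
    {P : ℤ[X] | P.natDegree ≤ n ∧ 0 < |aeval ζ P| ∧
      |aeval ζ P| ≤ P.supNorm ^ (-w)}.Infinite := by
  obtain ⟨_, ⟨w', rfl, hinf⟩, hlt⟩ := lt_sSup_iff.1 h
  refine hinf.mono fun P hP => ⟨hP.1, hP.2.1, hP.2.2.trans ?_⟩
  have hP0 : P ≠ 0 := by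
    rintro rfl
    simpa using hP.2.1
  exact Real.rpow_le_rpow_of_exponent_le (one_le_supNorm hP0)
    (neg_le_neg (EReal.coe_lt_coe_iff.1 hlt).le)

/-- The values at `0, …, n` of infinitely many polynomials show that one integer `a` serves
infinitely many of them in `le_lambdaExp_of_infinite`.  If `C * n ≤ m`, the bound is not positive
and holds trivially. -/
theorem le_lambdaExp_add {ζ : ℝ} (hζ : Transcendental ℚ ζ) {m n : ℕ} (hn : 1 ≤ n) {C : ℝ}
    (hC : 0 ≤ C) (h : ((C * (n : ℝ) : ℝ) : EReal) ≤ wExp n ζ) :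
    (((C * (n : ℝ) - (m : ℝ)) / ((m : ℝ) + (n : ℝ) * (1 + C * ((n : ℝ) - 1))) : ℝ) : EReal)
      ≤ lambdaExp (m + n) ζ := by
  have hn1 : (1 : ℝ) ≤ n := by exact_mod_cast hn
  have hden : ∀ w : ℝ, 0 ≤ w → 0 < (n - 1) * w + n + m := fun w hw => by
    have : 0 ≤ ((n : ℝ) - 1) * w := mul_nonneg (by linarith) hw
    positivity
  have hdeneq : (m : ℝ) + (n : ℝ) * (1 + C * ((n : ℝ) - 1)) = (n - 1) * (C * n) + n + m := by ring
  rw [hdeneq]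
  have hCn : 0 ≤ C * n := by positivity
  rcases le_or_gt (C * n) m with hle | hlt
  · refine le_trans ?_ (zero_le_lambdaExp _ _)
    exact_mod_cast div_nonpos_of_nonpos_of_nonneg (by linarith) (hden _ hCn).le
  refine EReal.ge_of_forall_gt_iff_ge.1 fun l hl => ?_
  have hl' := EReal.coe_lt_coe_iff.1 hl
  rw [lt_div_iff₀ (hden _ hCn)] at hl'
  -- By continuity the strict inequality persists for some `w` below `C * n`.
  have hcont : Tendsto (fun w : ℝ => w - m - l * ((n - 1) * w + n + m))
      (nhdsWithin (C * n) (Set.Iio (C * n)))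
      (nhds (C * n - m - l * ((n - 1) * (C * n) + n + m))) :=
    (Continuous.tendsto (by fun_prop) _).mono_left nhdsWithin_le_nhds
  obtain ⟨w, hw1, hw2, hw3⟩ := ((hcont.eventually (lt_mem_nhds (sub_pos.2 hl'))).and
    (((lt_mem_nhds hlt).filter_mono nhdsWithin_le_nhds).and self_mem_nhdsWithin)).exists
  have hinf := infinite_of_lt_wExp (lt_of_lt_of_le (EReal.coe_lt_coe_iff.2 hw3) h)
  obtain ⟨c, hc, hex⟩ := exists_supNorm_le_abs_eval n
  have hcover : {P : ℤ[X] | P.natDegree ≤ n ∧ 0 < |aeval ζ P| ∧ |aeval ζ P| ≤ P.supNorm ^ (-w)} ⊆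
      ⋃ a ∈ Finset.range (n + 1), {P : ℤ[X] | P.natDegree ≤ n ∧ |aeval ζ P| ≤ P.supNorm ^ (-w) ∧
        c * P.supNorm ≤ |((P.eval ((a : ℕ) : ℤ) : ℤ) : ℝ)|} := by
    intro P hP
    obtain ⟨a, ha, hle⟩ := hex P hP.1
    exact Set.mem_biUnion ha ⟨hP.1, hP.2.2, hle⟩
  obtain ⟨a, ha⟩ : ∃ a : ℕ, {P : ℤ[X] | P.natDegree ≤ n ∧ |aeval ζ P| ≤ P.supNorm ^ (-w) ∧
        c * P.supNorm ≤ |((P.eval ((a : ℕ) : ℤ) : ℤ) : ℝ)|}.Infinite := by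
    by_contra hfin
    simp only [Set.not_infinite, not_exists] at hfin
    exact hinf ((Set.Finite.biUnion (Finset.finite_toSet _) fun a _ => hfin a).subset hcover)
  refine le_lambdaExp_of_infinite hn (a : ℤ) ?_ hw2 hc (by linarith) ha
  rintro rfl
  exact hζ (by simpa using isAlgebraic_algebraMap (R := ℚ) (A := ℝ) (a : ℚ))

/-! ### The lower bound `n ≤ w_n` -/

/-- Minkowski's theorem applied to the forms `∑ v_l ζ ^ l` and `v_l`, `1 ≤ l ≤ n`. -/
theorem exists_abs_aeval_lt (n : ℕ) (ζ : ℝ) {H : ℝ} (hH : 1 ≤ H) :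
    ∃ P : ℤ[X], P ≠ 0 ∧ P.natDegree ≤ n ∧ |aeval ζ P| < 2 / H ^ n ∧
      P.supNorm ≤ (3 + ∑ l ∈ Finset.range n, |ζ| ^ (l + 1)) * H := by
  have hH0 : 0 < H := by linarith
  set A : Matrix (Fin (n + 1)) (Fin (n + 1)) ℝ :=
    Matrix.of fun i l => if i = 0 then ζ ^ (l : ℕ) else if l = i then 1 else 0 with hA
  have hdet : A.det = 1 := by
    rw [Matrix.det_of_isUpperTriangular]
    · refine Finset.prod_eq_one fun i _ => ?_
      by_cases hi : i = 0
      · simp [hA, hi]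
      · simp [hA, hi]
    · intro i j hij
      have hij' : j < i := hij
      have h1 : i ≠ 0 := (Fin.zero_le j |>.trans_lt hij').ne'
      simp [hA, h1, hij'.ne]
  obtain ⟨v, hv0, hv⟩ := exists_int_linear_forms_lt A
    (fun i => if i = 0 then 2 / H ^ n else H)
    (by intro i; split_ifs <;> positivity) (by rw [hdet]; exact one_ne_zero)
    (by
      rw [hdet, Fin.prod_univ_succ]
      have : (2 : ℝ) / H ^ n * H ^ n = 2 := by field_simp
      simp [Fin.succ_ne_zero, this])
  have hval : |∑ l : Fin (n + 1), ζ ^ (l : ℕ) * v l| < 2 / H ^ n := by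
    simpa [hA] using hv 0
  have hcoef : ∀ l : Fin n, |(v l.succ : ℝ)| ≤ H := by
    intro l
    have := hv l.succ
    simpa [hA, Fin.succ_ne_zero] using this.le
  have hbound : ∀ l, |(v l : ℝ)| ≤ (3 + ∑ l ∈ Finset.range n, |ζ| ^ (l + 1)) * H := by
    have hS : 0 ≤ ∑ l ∈ Finset.range n, |ζ| ^ (l + 1) := by positivity
    intro l
    refine Fin.cases ?_ (fun l => ?_) l
    · rw [Fin.sum_univ_succ] at hval
      simp only [Fin.val_zero, pow_zero, one_mul, Fin.val_succ] at hval
      have h1 : |∑ l : Fin n, ζ ^ ((l : ℕ) + 1) * (v l.succ : ℝ)|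
          ≤ (∑ l ∈ Finset.range n, |ζ| ^ (l + 1)) * H := by
        refine (Finset.abs_sum_le_sum_abs _ _).trans ?_
        rw [← Fin.sum_univ_eq_sum_range (fun l => |ζ| ^ (l + 1)), Finset.sum_mul]
        refine Finset.sum_le_sum fun l _ => ?_
        rw [abs_mul, abs_pow]
        exact mul_le_mul_of_nonneg_left (hcoef l) (by positivity)
      have h2 : 2 / H ^ n ≤ 2 := div_le_self (by norm_num) (one_le_pow₀ hH)
      have h3 := abs_sub (v 0 + ∑ l : Fin n, ζ ^ ((l : ℕ) + 1) * (v l.succ : ℝ))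
        (∑ l : Fin n, ζ ^ ((l : ℕ) + 1) * (v l.succ : ℝ))
      rw [add_sub_cancel_right] at h3
      nlinarith
    · refine (hcoef l).trans ?_
      nlinarith
  refine ⟨ofFn (n + 1) v, ?_, ?_, ?_, ?_⟩
  · intro h
    apply hv0
    ext i
    rw [Pi.zero_apply, ← Fin.eta i i.2, ← ofFn_coeff_eq_val_of_lt v i.2, h, coeff_zero]
  · exact Nat.lt_succ_iff.1 (ofFn_natDegree_lt (by omega) v)
  · rw [aeval_eq_sum_range' (ofFn_natDegree_lt (by omega) v), ← Fin.sum_univ_eq_sum_range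
      (fun i => (ofFn (n + 1) v).coeff i • ζ ^ i)]
    have : ∀ i : Fin (n + 1), (ofFn (n + 1) v).coeff i • ζ ^ (i : ℕ) = ζ ^ (i : ℕ) * v i := by
      intro i
      rw [ofFn_coeff_eq_val_of_lt v i.2, zsmul_eq_mul, mul_comm]
    simpa only [this] using hval
  · obtain ⟨k, hk⟩ := (ofFn (n + 1) v).exists_eq_supNorm
    rw [hk, Int.norm_eq_abs]
    rcases Nat.lt_or_ge k (n + 1) with hkn | hkn
    · rw [ofFn_coeff_eq_val_of_lt v hkn]
      exact hbound _
    · rw [ofFn_coeff_eq_zero_of_ge v hkn]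
      simp only [Int.cast_zero, abs_zero]
      positivity

theorem natCast_le_wExp {ζ : ℝ} (hζ : Transcendental ℚ ζ) {n : ℕ} (hn : 1 ≤ n) :
    (n : EReal) ≤ wExp n ζ := by
  refine EReal.ge_of_forall_gt_iff_ge.1 fun l hl => ?_
  have hn0 : (0 : ℝ) < n := by exact_mod_cast hn
  have hl' : l < n := by exact_mod_cast hl
  set w : ℝ := max l 0 with hw
  have hwn : w < n := max_lt hl' hn0
  have hw0 : 0 ≤ w := le_max_right _ _
  refine le_trans (EReal.coe_le_coe_iff.2 (le_max_left l 0)) (le_sSup ⟨w, rfl, fun hfin => ?_⟩)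
  set c : ℝ := 3 + ∑ l ∈ Finset.range n, |ζ| ^ (l + 1) with hc
  have hc0 : 0 < c := by positivity
  -- For large `H`, the polynomial found by Minkowski's theorem lies in the finite solution set,
  -- but takes a smaller value at `ζ` than all members of that set.
  have hsmall : ∀ᶠ H : ℝ in atTop, ∀ P ∈ {P : ℤ[X] | P.natDegree ≤ n ∧ 0 < |aeval ζ P| ∧
      |aeval ζ P| ≤ P.supNorm ^ (-w)}, 2 / H ^ n < |aeval ζ P| := by
    rw [eventually_all_finite hfin]
    intro P hP
    have hlim : Tendsto (fun H : ℝ => 2 / H ^ n) atTop (nhds 0) :=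
      tendsto_const_nhds.div_atTop (tendsto_pow_atTop (by omega))
    exact hlim.eventually (gt_mem_nhds hP.2.1)
  have hpow : ∀ᶠ H : ℝ in atTop, 2 * c ^ w * H ^ (-(n - w)) < 1 := by
    have hlim : Tendsto (fun H : ℝ => 2 * c ^ w * H ^ (-(n - w))) atTop (nhds 0) := by
      simpa using (tendsto_rpow_neg_atTop (sub_pos.2 hwn)).const_mul (2 * c ^ w)
    exact hlim.eventually (gt_mem_nhds one_pos)
  obtain ⟨H, hH1, hH2, hH⟩ := (hsmall.and (hpow.and (eventually_ge_atTop 1))).exists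
  have hH0 : 0 < H := by linarith
  obtain ⟨P, hP0, hPn, hPζ, hPH⟩ := exists_abs_aeval_lt n ζ hH
  refine lt_asymm hPζ (hH1 P ⟨hPn, abs_pos.2 fun h => ?_, hPζ.le.trans ?_⟩)
  · refine hζ ⟨P.map (Int.castRingHom ℚ), ?_, ?_⟩
    · rwa [Ne, Polynomial.map_eq_zero_iff (RingHom.injective_int _)]
    · rw [← algebraMap_int_eq, aeval_map_algebraMap, h]
  · have h1 : (c * H) ^ (-w) ≤ P.supNorm ^ (-w) :=
      Real.rpow_le_rpow_of_nonpos (by linarith [one_le_supNorm hP0]) hPH (by linarith)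
    refine le_trans ?_ h1
    rw [Real.mul_rpow hc0.le hH0.le, Real.rpow_neg hc0.le, ← div_eq_inv_mul,
      le_div_iff₀ (by positivity)]
    have h2 : 2 / H ^ n = 2 * (H ^ (-(n - w)) * H ^ (-w)) := by
      rw [← Real.rpow_add hH0, div_eq_mul_inv, ← Real.rpow_natCast, ← Real.rpow_neg hH0.le]
      congr 2
      ring
    rw [h2]
    calc 2 * (H ^ (-(n - w)) * H ^ (-w)) * c ^ w
        = 2 * c ^ w * H ^ (-(n - w)) * H ^ (-w) := by ring
      _ ≤ 1 * H ^ (-w) := by gcongr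
      _ = _ := one_mul _

/-! ### Asymptotics in `n` -/

theorem tendsto_mul_exponent {ι : Type*} {l : Filter ι} {m n : ι → ℕ} {C : ℝ} (hC : 1 ≤ C)
    (hn : Tendsto n l atTop)
    (hm : Tendsto (fun k => (m k : ℝ) / n k) l (nhds ((C - 1) / 2))) :
    Tendsto (fun k => ((m k + n k : ℕ) : ℝ) * ((C * (n k : ℝ) - (m k : ℝ)) /
      ((m k : ℝ) + (n k : ℝ) * (1 + C * ((n k : ℝ) - 1))))) l
      (nhds ((C + 1) ^ 2 / (4 * C))) := by
  have hs : Tendsto (fun k => (n k : ℝ)⁻¹) l (nhds 0) :=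
    tendsto_inv_atTop_zero.comp (tendsto_natCast_atTop_atTop.comp hn)
  have hC0 : C ≠ 0 := by linarith
  have hlim : Tendsto (fun k => ((m k : ℝ) / n k + 1) * (C - (m k : ℝ) / n k) /
      ((m k : ℝ) / n k * (n k : ℝ)⁻¹ + (n k : ℝ)⁻¹ + C * (1 - (n k : ℝ)⁻¹))) l
      (nhds (((C - 1) / 2 + 1) * (C - (C - 1) / 2) / ((C - 1) / 2 * 0 + 0 + C * (1 - 0)))) :=
    ((hm.add_const 1).mul (hm.const_sub C)).div
      (((hm.mul hs).add hs).add ((hs.const_sub 1).const_mul C)) (by simpa using hC0)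
  have heq : ((C - 1) / 2 + 1) * (C - (C - 1) / 2) / ((C - 1) / 2 * 0 + 0 + C * (1 - 0))
      = (C + 1) ^ 2 / (4 * C) := by
    field_simp
    ring
  rw [heq] at hlim
  refine hlim.congr' ?_
  filter_upwards [hn.eventually_ge_atTop 1] with k hk
  have hn0 : (n k : ℝ) ≠ 0 := by positivity
  have hden : (m k : ℝ) / n k * (n k : ℝ)⁻¹ + (n k : ℝ)⁻¹ + C * (1 - (n k : ℝ)⁻¹)
      = ((m k : ℝ) + (n k : ℝ) * (1 + C * ((n k : ℝ) - 1))) / (n k : ℝ) ^ 2 := by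
    field_simp
    ring
  have hnum : ((m k : ℝ) / n k + 1) * (C - (m k : ℝ) / n k)
      = (((m k + n k : ℕ) : ℝ) * (C * (n k : ℝ) - (m k : ℝ))) / (n k : ℝ) ^ 2 := by
    push_cast
    field_simp
  rw [hden, hnum, div_div_div_cancel_right₀ (pow_ne_zero 2 hn0), mul_div_assoc]

theorem coe_mul_exponent_le {ζ : ℝ} (hζ : Transcendental ℚ ζ) {m n : ℕ} (hn : 1 ≤ n) {C g : ℝ}
    (hC : 0 ≤ C) (h : ((C * (n : ℝ) : ℝ) : EReal) ≤ wExp n ζ)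
    (hg : g ≤ ((m + n : ℕ) : ℝ) * ((C * (n : ℝ) - (m : ℝ)) /
      ((m : ℝ) + (n : ℝ) * (1 + C * ((n : ℝ) - 1))))) :
    (g : EReal) ≤ ((m + n : ℕ) : EReal) * lambdaExp (m + n) ζ := by
  refine (EReal.coe_le_coe_iff.2 hg).trans ?_
  rw [EReal.coe_mul]
  exact mul_le_mul_of_nonneg_left (le_lambdaExp_add hζ hn hC h) (by positivity)

theorem le_lambdaUpper {ζ : ℝ} (hζ : Transcendental ℚ ζ) {C : ℝ} (hC : 1 ≤ C)
    (h : ∃ᶠ n : ℕ in atTop, ((C * (n : ℝ) : ℝ) : EReal) ≤ wExp n ζ) :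
    (((C + 1) ^ 2 / (4 * C) : ℝ) : EReal) ≤ lambdaUpper ζ := by
  refine EReal.ge_of_forall_gt_iff_ge.1 fun g hg => ?_
  have hg' := EReal.coe_lt_coe_iff.1 hg
  set m : ℕ → ℕ := fun n => ⌊(C - 1) / 2 * (n : ℝ)⌋₊ with hm
  have hlim := tendsto_mul_exponent (m := m) hC tendsto_id
    ((tendsto_nat_floor_mul_div_atTop (by linarith : 0 ≤ (C - 1) / 2)).comp
      tendsto_natCast_atTop_atTop)
  have hN : Tendsto (fun n => m n + n) atTop atTop :=
    tendsto_atTop_mono (fun n => Nat.le_add_left n (m n)) tendsto_id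
  refine le_limsup_of_frequently_le (hN.frequently ?_)
  refine (h.and_eventually ((hlim.eventually (lt_mem_nhds hg')).and
    (eventually_ge_atTop 1))).mono ?_
  rintro n ⟨hw, hlt, hn⟩
  exact coe_mul_exponent_le hζ hn (by linarith) hw hlt.le

theorem le_lambdaLower {ζ : ℝ} (hζ : Transcendental ℚ ζ) {C : ℝ} (hC : 1 ≤ C)
    (h : ∀ᶠ n : ℕ in atTop, ((C * (n : ℝ) : ℝ) : EReal) ≤ wExp n ζ) :
    (((C + 1) ^ 2 / (4 * C) : ℝ) : EReal) ≤ lambdaLower ζ := by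
  refine EReal.ge_of_forall_gt_iff_ge.1 fun g hg => ?_
  have hg' := EReal.coe_lt_coe_iff.1 hg
  -- Given `N = m + n`, the optimal ratio `m / n = (C - 1) / 2` amounts to `n / N = 2 / (C + 1)`.
  set θ : ℝ := 2 / (C + 1) with hθ
  have hθ0 : 0 < θ := by positivity
  have hθ1 : θ ≤ 1 := by rw [hθ, div_le_one (by linarith)]; linarith
  set n : ℕ → ℕ := fun N => ⌊θ * (N : ℝ)⌋₊ with hn
  have hnN : ∀ N, n N ≤ N := fun N => by
    refine Nat.floor_le_of_le ?_
    exact mul_le_of_le_one_left (Nat.cast_nonneg N) hθ1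
  have hntop : Tendsto n atTop atTop :=
    tendsto_nat_floor_atTop.comp (tendsto_natCast_atTop_atTop.const_mul_atTop hθ0)
  have hratio : Tendsto (fun N => (n N : ℝ) / N) atTop (nhds θ) :=
    (tendsto_nat_floor_mul_div_atTop hθ0.le).comp tendsto_natCast_atTop_atTop
  have hm : Tendsto (fun N => ((N - n N : ℕ) : ℝ) / n N) atTop (nhds ((C - 1) / 2)) := by
    have h1 := (hratio.inv₀ hθ0.ne').sub_const 1
    have h2 : θ⁻¹ - 1 = (C - 1) / 2 := by rw [hθ, inv_div]; ring
    rw [h2] at h1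
    refine h1.congr' ?_
    filter_upwards [hntop.eventually_ge_atTop 1] with N hN
    have hn0 : (n N : ℝ) ≠ 0 := by positivity
    rw [Nat.cast_sub (hnN N), inv_div, sub_div, div_self hn0]
  have hlim := tendsto_mul_exponent (m := fun N => N - n N) hC hntop hm
  refine le_liminf_of_le (by isBoundedDefault) ?_
  filter_upwards [hlim.eventually (lt_mem_nhds hg'), hntop.eventually h,
    hntop.eventually_ge_atTop 1] with N hlt hw hN
  have := coe_mul_exponent_le hζ hN (by linarith) hw hlt.le
  rwa [Nat.sub_add_cancel (hnN N)] at this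

/-- It suffices to approach `W` from below by real numbers `C ≥ 1`; when `W = 1` there are none, and
`C = 1` itself is used. -/
theorem quadRatio_le {W L : EReal} (hW : 1 ≤ W)
    (h : ∀ C : ℝ, 1 ≤ C → ((C : EReal) < W ∨ C = 1) →
      (((C + 1) ^ 2 / (4 * C) : ℝ) : EReal) ≤ L) : quadRatio W ≤ L := by
  induction W with
  | bot => exact absurd hW (not_le.2 (EReal.bot_lt_coe 1))
  | top =>
    have hL : L = ⊤ := by
      rw [EReal.eq_top_iff_forall_lt]
      intro y
      have hC : 1 ≤ 4 * |y| + 1 := by linarith [abs_nonneg y]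
      refine lt_of_lt_of_le ?_ (h (4 * |y| + 1) hC (Or.inl (EReal.coe_lt_top _)))
      rw [EReal.coe_lt_coe_iff, lt_div_iff₀ (by linarith)]
      nlinarith [le_abs_self y, abs_nonneg y]
    rw [hL]
    exact le_top
  | coe w =>
    have hw : 1 ≤ w := by exact_mod_cast hW
    have hq : quadRatio (w : EReal) = (((w + 1) ^ 2 / (4 * w) : ℝ) : EReal) := by
      rw [quadRatio, if_neg (EReal.coe_ne_top w), EReal.coe_div, EReal.coe_pow, EReal.coe_add,
        EReal.coe_mul, EReal.coe_one]
      rfl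
    rw [hq]
    rcases hw.eq_or_lt with rfl | hlt
    · exact h 1 le_rfl (Or.inr rfl)
    · have hlim : Tendsto (fun C : ℝ => (((C + 1) ^ 2 / (4 * C) : ℝ) : EReal))
          (nhdsWithin w (Set.Iio w)) (nhds (((w + 1) ^ 2 / (4 * w) : ℝ) : EReal)) := by
        refine (continuous_coe_real_ereal.tendsto _).comp (Tendsto.mono_left ?_ nhdsWithin_le_nhds)
        exact ContinuousAt.div (by fun_prop) (by fun_prop) (by positivity)
      refine le_of_tendsto hlim ?_
      filter_upwards [(lt_mem_nhds hlt).filter_mono nhdsWithin_le_nhds, self_mem_nhdsWithin]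
        with C hC1 hC2
      exact h C hC1.le (Or.inl (EReal.coe_lt_coe_iff.2 hC2))

theorem mul_le_of_le_div {a : ℝ} {b : EReal} {n : ℕ} (hn : 1 ≤ n) (h : (a : EReal) ≤ b / n) :
    ((a * (n : ℝ) : ℝ) : EReal) ≤ b := by
  rw [EReal.le_div_iff_mul_le (by exact_mod_cast hn) (EReal.natCast_ne_top n)] at h
  rwa [EReal.coe_mul]

theorem one_le_wLower {ζ : ℝ} (hζ : Transcendental ℚ ζ) : 1 ≤ wLower ζ := by
  refine le_liminf_of_le (by isBoundedDefault) ?_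
  filter_upwards [eventually_ge_atTop 1] with n hn
  rw [EReal.le_div_iff_mul_le (by exact_mod_cast hn) (EReal.natCast_ne_top n), one_mul]
  exact natCast_le_wExp hζ hn

theorem eventually_one_mul_le_wExp {ζ : ℝ} (hζ : Transcendental ℚ ζ) :
    ∀ᶠ n : ℕ in atTop, (((1 : ℝ) * (n : ℝ) : ℝ) : EReal) ≤ wExp n ζ :=
  (eventually_ge_atTop 1).mono fun n hn => by simpa using natCast_le_wExp hζ hn

theorem quadRatio_wUpper_le {ζ : ℝ} (hζ : Transcendental ℚ ζ) :
    quadRatio (wUpper ζ) ≤ lambdaUpper ζ := by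
  refine quadRatio_le ((one_le_wLower hζ).trans (liminf_le_limsup)) fun C hC hCW => ?_
  refine le_lambdaUpper hζ hC ?_
  rcases hCW with hlt | rfl
  · refine ((frequently_lt_of_lt_limsup (by isBoundedDefault) hlt).and_eventually
      (eventually_ge_atTop 1)).mono ?_
    rintro n ⟨h1, h2⟩
    exact mul_le_of_le_div h2 h1.le
  · exact (eventually_one_mul_le_wExp hζ).frequently

theorem quadRatio_wLower_le {ζ : ℝ} (hζ : Transcendental ℚ ζ) :
    quadRatio (wLower ζ) ≤ lambdaLower ζ := by
  refine quadRatio_le (one_le_wLower hζ) fun C hC hCW => ?_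
  refine le_lambdaLower hζ hC ?_
  rcases hCW with hlt | rfl
  · filter_upwards [eventually_lt_of_lt_liminf hlt, eventually_ge_atTop 1] with n h1 h2
    exact mul_le_of_le_div h2 h1.le
  · exact eventually_one_mul_le_wExp hζ

end DiophExp

theorem theorem3p4 (ζ : ℝ) (hζ : Transcendental ℚ ζ) :
    DiophExp.quadRatio (DiophExp.wUpper ζ) ≤ DiophExp.lambdaUpper ζ ∧
    DiophExp.quadRatio (DiophExp.wLower ζ) ≤ DiophExp.lambdaLower ζ ∧
    (DiophExp.IsTNumber ζ →
      limsup (fun n : ℕ => (n : EReal) * DiophExp.lambdaExp n ζ) atTop = ⊤) ∧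
    (∀ (m n : ℕ), 1 ≤ m → 1 ≤ n → ∀ C : ℝ, 1 ≤ C →
      ((C * (n : ℝ) : ℝ) : EReal) ≤ DiophExp.wExp n ζ →
      (((C * (n : ℝ) - (m : ℝ)) / ((m : ℝ) + (n : ℝ) * (1 + C * ((n : ℝ) - 1))) : ℝ) : EReal)
        ≤ DiophExp.lambdaExp (m + n) ζ) := by
  refine ⟨DiophExp.quadRatio_wUpper_le hζ, DiophExp.quadRatio_wLower_le hζ, fun hT => ?_,
    fun m n _ hn C hC h => DiophExp.le_lambdaExp_add hζ hn (by linarith) h⟩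
  have h := DiophExp.quadRatio_wUpper_le hζ
  rw [hT.2.2, DiophExp.quadRatio, if_pos rfl] at h
  exact top_le_iff.1 h
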